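/- Theorem 2.1. Let $1\le k\le n$ be integers. For a real symmetric matrix $A$, let $\sigma_j(A)$ be the $j$-th elementary symmetric function of its eigenvalues ($\sigma_0(A)=1$), and let $$T_{k-1}(A)=\sum_{j=0}^{k-1}(-1)^j\,\sigma_{k-1-j}(A)\,A^j$$ be the $(k-1)$-st Newton transformation. Let $\Gamma_k^+$ be the set of real symmetric $n\times n$ matrices $A$ with $\sigma_j(A)>0$ for all $1\le j\le k$. For a real symmetric $(n+1)\times(n+1)$ matrix $R=(r_{ij})_{0\le i,j\le n}$ write $r=(r_{ij})_{1\le i,j\le n}$ and $x=(r_{01},\dots,r_{0n})$, and define $$F_k(R)=r_{00}\,\sigma_k(r)-\langle T_{k-1}(r),x\otimes x\rangle=r_{00}\,\sigma_k(r)-x\,T_{k-1}(r)\,x^{T}.$$ Then the set $$\mathcal S=\{R \text{ real symmetric } (n+1)\times(n+1) : r\in\Gamma_k^+,\ F_k(R)>0\}$$ is a convex cone (closed under addition and under multiplication by positive scalars), the function $F_k^{1/(k+1)}$ is concave on $\mathcal S$, and hence $\log F_k$ is concave on $\mathcal S$. -/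

import Mathlib

/-- `σ_k(A)`: the `k`-th elementary symmetric function of the eigenvalues of `A`, that is, of the
real roots of the characteristic polynomial counted with multiplicity. It is only used for real
symmetric matrices, which have all their `m` eigenvalues real. In particular `σ_0(A) = 1`. -/
noncomputable def sigma {m : ℕ} (k : ℕ) (A : Matrix (Fin m) (Fin m) ℝ) : ℝ :=
  A.charpoly.roots.esymm k

/-- The cone `Γ_k^+` of symmetric matrices `A` with `σ_j(A) > 0` for all `1 ≤ j ≤ k`. -/
def gammaPlus (m k : ℕ) : Set (Matrix (Fin m) (Fin m) ℝ) :=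
  {A | A.IsSymm ∧ ∀ j : ℕ, 1 ≤ j → j ≤ k → 0 < sigma j A}

/-- The `k`-th Newton transformation
`T_k(A) = σ_k(A) I - σ_{k-1}(A) A + ⋯ + (-1)^k A^k`. -/
noncomputable def newtonTransform {m : ℕ} (k : ℕ) (A : Matrix (Fin m) (Fin m) ℝ) :
    Matrix (Fin m) (Fin m) ℝ :=
  ∑ j ∈ Finset.range (k + 1), ((-1 : ℝ) ^ j * sigma (k - j) A) • A ^ j

/-- The block `r = (r_{ij})`, `1 ≤ i, j ≤ n`, of `R = (r_{ij})`, `0 ≤ i, j ≤ n`. -/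
def lowerBlock {n : ℕ} (R : Matrix (Fin (n + 1)) (Fin (n + 1)) ℝ) : Matrix (Fin n) (Fin n) ℝ :=
  R.submatrix Fin.succ Fin.succ

/-- The vector `x = (r_{01}, …, r_{0n})`. -/
def topRow {n : ℕ} (R : Matrix (Fin (n + 1)) (Fin (n + 1)) ℝ) : Fin n → ℝ :=
  fun i => R 0 i.succ

/-- `F_k(R) = r_{00} σ_k(r) - ⟨T_{k-1}(r), x ⊗ x⟩`, where `⟨T, x ⊗ x⟩ = x T xᵀ`; used for
`k ≥ 1` only. -/
noncomputable def gsOperator {n : ℕ} (k : ℕ) (R : Matrix (Fin (n + 1)) (Fin (n + 1)) ℝ) : ℝ :=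
  R 0 0 * sigma k (lowerBlock R) -
    dotProduct (topRow R) ((newtonTransform (k - 1) (lowerBlock R)).mulVec (topRow R))

/-- The set `S` of symmetric `(n+1) × (n+1)` matrices `R` with `r ∈ Γ_k^+` and `F_k(R) > 0`. -/
def gsCone (n k : ℕ) : Set (Matrix (Fin (n + 1)) (Fin (n + 1)) ℝ) :=
  {R | R.IsSymm ∧ lowerBlock R ∈ gammaPlus n k ∧ 0 < gsOperator k R}

/-! The idea is to pass to the Schur complement `Y = r - xᵀx / r₀₀`. Each `σ_j` is affine along
rank-one perturbations, with slope given by the Newton transformation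
(`sigma_succ_add_smul_vecMulVec`), so `F_k(R) = r₀₀ σ_k(Y)`. By Newton's inequalities, `R` lies in
the cone exactly when it is symmetric, `r₀₀ > 0` and `Y ∈ Γ_k^+` (`mem_gsCone_iff`).

Hence `F_k` is the product of the `k + 1` positive factors `r₀₀` and `σ_{j+1}(Y) / σ_j(Y)`, `j < k`.
Each factor is homogeneous of degree one and superadditive in `R`, for three reasons: the quotients
are superadditive on `Γ_k^+` (Marcus–Lopes), they increase when a nonnegative rank-one matrix is
added, and `Y` is superadditive up to such a matrix (`cornerSchurComplement_add`). Superadditivity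
of the geometric mean then gives that of `F_k^{1/(k+1)}`, and with homogeneity this is concavity.

The Marcus–Lopes inequality is proved for vectors by induction on the degree and carried to matrices
by taking diagonals in an eigenbasis of the sum; Birkhoff's theorem shows that this does not
decrease the quotients of the summands. -/

/-- The `j`-th elementary symmetric function of the family `(f i)`, `i ∈ s`. -/
noncomputable def esymmOn {ι : Type*} (s : Finset ι) (f : ι → ℝ) (j : ℕ) : ℝ :=
  ∑ t ∈ s.powersetCard j, ∏ i ∈ t, f i

/-! ### Elementary symmetric functions of finite families. -/

section ElementarySymmetric

variable {ι : Type*}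

@[simp] lemma esymmOn_zero (s : Finset ι) (f : ι → ℝ) : esymmOn s f 0 = 1 := by
  simp [esymmOn]

lemma esymmOn_empty_succ (f : ι → ℝ) (j : ℕ) : esymmOn ∅ f (j + 1) = 0 := by
  rw [esymmOn, Finset.powersetCard_eq_empty.2 (by simp), Finset.sum_empty]

lemma esymmOn_one (s : Finset ι) (f : ι → ℝ) : esymmOn s f 1 = ∑ i ∈ s, f i := by
  simp [esymmOn, Finset.powersetCard_one]

lemma esymmOn_smul (s : Finset ι) (f : ι → ℝ) (c : ℝ) (j : ℕ) :
    esymmOn s (c • f) j = c ^ j * esymmOn s f j := by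
  unfold esymmOn
  rw [Finset.mul_sum]
  refine Finset.sum_congr rfl fun t ht => ?_
  rw [Finset.mem_powersetCard] at ht
  simp [Finset.prod_mul_distrib, ht.2]

lemma esymmOn_comp_equiv [Fintype ι] (f : ι → ℝ) (π : Equiv.Perm ι) (j : ℕ) :
    esymmOn Finset.univ (f ∘ π) j = esymmOn Finset.univ f j := by
  unfold esymmOn
  rw [← Finset.esymm_map_val, ← Finset.esymm_map_val, ← Multiset.map_map]
  congr 2
  rw [← Equiv.coe_toEmbedding, ← Finset.map_val, Finset.map_univ_equiv]

variable [DecidableEq ι]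

lemma esymmOn_insert_succ {s : Finset ι} {a : ι} (ha : a ∉ s) (f : ι → ℝ) (j : ℕ) :
    esymmOn (insert a s) f (j + 1) = esymmOn s f (j + 1) + f a * esymmOn s f j := by
  unfold esymmOn
  rw [Finset.powersetCard_succ_insert ha, Finset.sum_union, Finset.sum_image, Finset.mul_sum]
  · congr 1
    refine Finset.sum_congr rfl fun t ht => ?_
    rw [Finset.mem_powersetCard] at ht
    rw [Finset.prod_insert fun h => ha (ht.1 h)]
  · intro t ht t' ht' h
    simp only [Finset.mem_coe, Finset.mem_powersetCard] at ht ht'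
    have h1 : a ∉ t := fun h => ha (ht.1 h)
    have h2 : a ∉ t' := fun h => ha (ht'.1 h)
    rw [← Finset.erase_insert h1, ← Finset.erase_insert h2, h]
  · rw [Finset.disjoint_left]
    intro t ht ht'
    rw [Finset.mem_powersetCard] at ht
    obtain ⟨t', -, rfl⟩ := Finset.mem_image.1 ht'
    exact ha (ht.1 (Finset.mem_insert_self _ _))

lemma esymmOn_erase_succ {s : Finset ι} {a : ι} (ha : a ∈ s) (f : ι → ℝ) (j : ℕ) :
    esymmOn s f (j + 1) = esymmOn (s.erase a) f (j + 1) + f a * esymmOn (s.erase a) f j := by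
  rw [← esymmOn_insert_succ (Finset.notMem_erase a s), Finset.insert_erase ha]

/-- Euler's identity for the homogeneous polynomial `esymmOn s · (j + 1)`. -/
lemma sum_mul_esymmOn_erase (s : Finset ι) (f : ι → ℝ) (j : ℕ) :
    ∑ i ∈ s, f i * esymmOn (s.erase i) f j = (j + 1) * esymmOn s f (j + 1) := by
  induction s using Finset.induction_on generalizing j with
  | empty => simp [esymmOn_empty_succ]
  | insert a s ha ih =>
    have key : ∀ i ∈ s, (insert a s).erase i = insert a (s.erase i) := fun i hi =>
      Finset.erase_insert_of_ne fun h => ha (h ▸ hi)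
    have hna : ∀ i, a ∉ s.erase i := fun i h => ha (Finset.mem_of_mem_erase h)
    rw [Finset.sum_insert ha, Finset.erase_insert ha, esymmOn_insert_succ ha]
    cases j with
    | zero =>
      simp [esymmOn_one]
      ring
    | succ j =>
      have : ∑ i ∈ s, f i * esymmOn ((insert a s).erase i) f (j + 1) =
          ∑ i ∈ s, f i * esymmOn (s.erase i) f (j + 1) +
            f a * ∑ i ∈ s, f i * esymmOn (s.erase i) f j := by
        rw [Finset.mul_sum, ← Finset.sum_add_distrib]
        refine Finset.sum_congr rfl fun i hi => ?_
        rw [key i hi, esymmOn_insert_succ (hna i)]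
        ring
      rw [this, ih, ih]
      push_cast
      ring

end ElementarySymmetric

/-! ### Newton's inequalities through real-rooted polynomials. -/

section Newton

open Polynomial

/-- Rolle's theorem: differentiation loses at most one root, counted with multiplicity. -/
lemma Polynomial.Splits.derivative_real {p : ℝ[X]} (hp : p.Splits) : p.derivative.Splits := by
  by_cases h0 : p.derivative = 0
  · rw [h0]; exact Polynomial.Splits.zero
  rw [splits_iff_card_roots] at hp ⊢
  have h1 := p.card_roots_le_derivative
  have h2 := natDegree_derivative_le p
  have h3 := p.derivative.card_roots'
  have h4 : p.natDegree ≠ 0 := fun h => h0 (derivative_of_natDegree_zero h)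
  omega

lemma Polynomial.Splits.iterate_derivative_real {p : ℝ[X]} (hp : p.Splits) (m : ℕ) :
    (derivative^[m] p).Splits := by
  induction m with
  | zero => simpa using hp
  | succ m ih => rw [Function.iterate_succ_apply']; exact ih.derivative_real

/-- Laguerre's inequality at the origin. -/
lemma Polynomial.Splits.two_mul_coeff_le {p : ℝ[X]} (hp : p.Splits) :
    2 * p.coeff 0 * p.coeff 2 ≤ p.coeff 1 ^ 2 := by
  rw [hp.eq_prod_roots]
  generalize p.roots = r
  suffices h : 2 * ((r.map fun a => X - C a).prod.coeff 0) * (r.map fun a => X - C a).prod.coeff 2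
      ≤ (r.map fun a => X - C a).prod.coeff 1 ^ 2 by
    simp only [coeff_C_mul]
    nlinarith [mul_le_mul_of_nonneg_left h (sq_nonneg p.leadingCoeff)]
  -- Multiplying `q` by `X - a` turns `D = c₁² - 2c₀c₂` into `c₀² + a² D`.
  induction r using Multiset.induction_on with
  | empty => simp [coeff_one]
  | cons a r ih =>
    simp only [Multiset.map_cons, Multiset.prod_cons]
    generalize (r.map fun a => X - C a).prod = q at ih ⊢
    have h1 : ((X - C a) * q).coeff 1 = q.coeff 0 - a * q.coeff 1 := by
      rw [sub_mul, coeff_sub, coeff_C_mul, coeff_X_mul]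
    have h2 : ((X - C a) * q).coeff 2 = q.coeff 1 - a * q.coeff 2 := by
      rw [sub_mul, coeff_sub, coeff_C_mul, coeff_X_mul]
    have h0 : ((X - C a) * q).coeff 0 = - a * q.coeff 0 := by
      simp [sub_mul]
    rw [h0, h1, h2]
    nlinarith [mul_le_mul_of_nonneg_left ih (sq_nonneg a), sq_nonneg (q.coeff 0)]

/-- Log-concavity of the coefficients of a real-rooted polynomial. -/
lemma Polynomial.Splits.coeff_mul_coeff_le {p : ℝ[X]} (hp : p.Splits) (m : ℕ) :
    p.coeff m * p.coeff (m + 2) ≤ p.coeff (m + 1) ^ 2 := by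
  have h := (hp.iterate_derivative_real m).two_mul_coeff_le
  simp only [coeff_iterate_derivative, zero_add, nsmul_eq_mul] at h
  rw [add_comm 2 m, add_comm 1 m, Nat.descFactorial_self] at h
  have e1 : (m + 1).descFactorial m = (m + 1) * m.factorial := by
    have := Nat.factorial_mul_descFactorial (n := m + 1) (k := m) (by omega)
    simpa [Nat.factorial_succ] using this
  have e2 : 2 * (m + 2).descFactorial m = (m + 2) * ((m + 1) * m.factorial) := by
    have := Nat.factorial_mul_descFactorial (n := m + 2) (k := m) (by omega)
    simpa [Nat.factorial_succ] using this
  have e2' : (2 : ℝ) * ((m + 2).descFactorial m : ℝ) = (m + 2) * ((m + 1) * m.factorial) := by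
    exact_mod_cast e2
  rw [e1] at h
  have hf : (0 : ℝ) < m.factorial := by exact_mod_cast m.factorial_pos
  push_cast at h
  -- Laguerre's inequality for the `m`-th derivative, with the common factor `(m!)² (m + 1)`
  -- cancelled.
  have h' : ((m : ℝ) + 2) * (p.coeff m * p.coeff (m + 2)) ≤
      ((m : ℝ) + 1) * p.coeff (m + 1) ^ 2 := by
    have : ((m.factorial : ℝ) ^ 2 * (m + 1)) * (((m : ℝ) + 2) * (p.coeff m * p.coeff (m + 2))) ≤
        ((m.factorial : ℝ) ^ 2 * (m + 1)) * (((m : ℝ) + 1) * p.coeff (m + 1) ^ 2) := by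
      calc _ = m.factorial * p.coeff m * p.coeff (m + 2) *
            ((m + 2) * ((m + 1) * m.factorial)) := by ring
        _ = 2 * (m.factorial * p.coeff m) * ((m + 2).descFactorial m * p.coeff (m + 2)) := by
          rw [← e2']; ring
        _ ≤ _ := h
        _ = _ := by ring
    exact le_of_mul_le_mul_left this (by positivity)
  rcases le_or_gt (p.coeff m * p.coeff (m + 2)) 0 with h0 | h0
  · exact h0.trans (sq_nonneg _)
  · have hm : (0 : ℝ) ≤ m := m.cast_nonneg
    have : ((m : ℝ) + 1) * (p.coeff m * p.coeff (m + 2)) ≤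
      ((m : ℝ) + 1) * p.coeff (m + 1) ^ 2 := by nlinarith
    exact le_of_mul_le_mul_left this (by positivity)

lemma coeff_prod_one_add_C_mul_X {ι : Type*} [DecidableEq ι] (s : Finset ι) (f : ι → ℝ) (j : ℕ) :
    (∏ i ∈ s, (1 + C (f i) * X)).coeff j = esymmOn s f j := by
  induction s using Finset.induction_on generalizing j with
  | empty =>
    cases j with
    | zero => simp
    | succ j => simp [esymmOn_empty_succ, coeff_one]
  | insert a s ha ih =>
    rw [Finset.prod_insert ha, add_mul, one_mul, coeff_add, mul_assoc, coeff_C_mul]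
    cases j with
    | zero => simp [ih]
    | succ j => rw [coeff_X_mul, ih, ih, esymmOn_insert_succ ha]

/-- Newton's inequality (without the binomial factors). -/
lemma esymmOn_mul_esymmOn_le {ι : Type*} [DecidableEq ι] (s : Finset ι) (f : ι → ℝ) (j : ℕ) :
    esymmOn s f j * esymmOn s f (j + 2) ≤ esymmOn s f (j + 1) ^ 2 := by
  simp only [← coeff_prod_one_add_C_mul_X]
  refine Polynomial.Splits.coeff_mul_coeff_le ?_ j
  refine Polynomial.Splits.prod fun i _ => ?_
  refine Polynomial.Splits.of_natDegree_le_one ?_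
  compute_degree

end Newton

/-! ### Superadditivity of the quotients for vectors. -/

/-- The family `(f i)`, `i ∈ s`, lies in the `k`-th Gårding cone. -/
def InGardingCone {ι : Type*} (k : ℕ) (s : Finset ι) (f : ι → ℝ) : Prop :=
  ∀ j ≤ k, 0 < esymmOn s f j

/-- The quotient of consecutive elementary symmetric functions. -/
noncomputable def esymmRatio {ι : Type*} (s : Finset ι) (f : ι → ℝ) (k : ℕ) : ℝ :=
  esymmOn s f (k + 1) / esymmOn s f k

section GardingCone

variable {ι : Type*}

lemma InGardingCone.mono {k l : ℕ} {s : Finset ι} {f : ι → ℝ} (h : InGardingCone l s f)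
    (hkl : k ≤ l) : InGardingCone k s f := fun j hj => h j (hj.trans hkl)

lemma InGardingCone.smul {k : ℕ} {s : Finset ι} {f : ι → ℝ} (h : InGardingCone k s f) {c : ℝ}
    (hc : 0 < c) : InGardingCone k s (c • f) := fun j hj => by
  rw [esymmOn_smul]
  exact mul_pos (pow_pos hc j) (h j hj)

lemma esymmRatio_smul (s : Finset ι) (f : ι → ℝ) (k : ℕ) {c : ℝ} (hc : 0 < c) :
    esymmRatio s (c • f) k = c * esymmRatio s f k := by
  unfold esymmRatio
  rw [esymmOn_smul, esymmOn_smul, pow_succ, mul_assoc, mul_div_mul_left _ _ (pow_pos hc k).ne',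
    mul_div_assoc]

lemma InGardingCone.succ_iff {k : ℕ} {s : Finset ι} {f : ι → ℝ} :
    InGardingCone (k + 1) s f ↔ InGardingCone k s f ∧ 0 < esymmOn s f (k + 1) := by
  refine ⟨fun h => ⟨h.mono (Nat.le_succ k), h _ le_rfl⟩, fun h j hj => ?_⟩
  rcases Nat.lt_or_ge k j with h' | h'
  · obtain rfl : j = k + 1 := by omega
    exact h.2
  · exact h.1 j h'

variable [DecidableEq ι]

lemma InGardingCone.erase {k : ℕ} {s : Finset ι} {f : ι → ℝ} (h : InGardingCone (k + 1) s f)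
    {i : ι} (hi : i ∈ s) : InGardingCone k (s.erase i) f := by
  induction k with
  | zero =>
    intro j hj
    obtain rfl : j = 0 := by omega
    simp
  | succ k ih =>
    have ih' := ih (h.mono (Nat.le_succ _))
    refine InGardingCone.succ_iff.2 ⟨ih', ?_⟩
    have h1 := h (k + 1) (by omega)
    have h2 := h (k + 2) le_rfl
    rw [esymmOn_erase_succ hi] at h1
    rw [esymmOn_erase_succ hi] at h2
    have h0 := ih' k le_rfl
    have hN := esymmOn_mul_esymmOn_le (s.erase i) f k
    -- With `a > 0 ≥ b`, `b + f i * a > 0` and `c + f i * b > 0` force `a * c > b²`, against Newton.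
    by_contra! hneg
    generalize esymmOn (s.erase i) f k = a at *
    generalize esymmOn (s.erase i) f (k + 1) = b at *
    generalize esymmOn (s.erase i) f (k + 1 + 1) = c at *
    nlinarith [mul_pos h0 h2, mul_nonneg h1.le (neg_nonneg.2 hneg)]

lemma add_sq_div_add_le {a b c d : ℝ} (hc : 0 < c) (hd : 0 < d) :
    (a + b) ^ 2 / (c + d) ≤ a ^ 2 / c + b ^ 2 / d := by
  rw [div_add_div _ _ hc.ne' hd.ne', div_le_div_iff₀ (by positivity) (by positivity)]
  nlinarith [mul_nonneg (mul_nonneg hc.le hd.le) (sq_nonneg (a * d - b * c)),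
    sq_nonneg (a * d - b * c), mul_pos hc hd]

lemma add_esymmRatio_erase {k : ℕ} {s : Finset ι} {f : ι → ℝ} (h : InGardingCone (k + 1) s f)
    {i : ι} (hi : i ∈ s) :
    f i + esymmRatio (s.erase i) f k = esymmOn s f (k + 1) / esymmOn (s.erase i) f k := by
  have h0 := h.erase hi k le_rfl
  rw [esymmOn_erase_succ hi, esymmRatio]
  field_simp
  ring

/-- Euler's identity, with `σ_{k+1}(s \ i) = σ_{k+1}(s) - f i σ_k(s \ i)`. It expresses a quotient
through quotients one degree lower, which makes the induction for superadditivity possible. -/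
lemma esymmRatio_succ_eq_sum {k : ℕ} {s : Finset ι} {f : ι → ℝ} (h : InGardingCone (k + 1) s f) :
    (k + 2 : ℝ) * esymmRatio s f (k + 1) =
      ∑ i ∈ s, (f i - f i ^ 2 / (f i + esymmRatio (s.erase i) f k)) := by
  have h1 := h (k + 1) le_rfl
  have hE := sum_mul_esymmOn_erase s f (k + 1)
  have : (k + 2 : ℝ) * esymmRatio s f (k + 1) =
      ((k + 1 : ℕ) + 1) * esymmOn s f (k + 1 + 1) / esymmOn s f (k + 1) := by
    rw [esymmRatio]; push_cast; ring
  rw [this, ← hE, Finset.sum_div]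
  refine Finset.sum_congr rfl fun i hi => ?_
  have h0 := h.erase hi k le_rfl
  rw [add_esymmRatio_erase h hi, div_div_eq_mul_div, eq_sub_iff_add_eq, ← add_div,
    div_eq_iff h1.ne', esymmOn_erase_succ hi]
  ring

/-- Marcus–Lopes: `x² / y` is subadditive and decreasing in `y > 0`, so the recursion passes
superadditivity up one degree. The sign of `σ_{k+1}` is left free because erasing an index costs one
degree of the cone. -/
theorem InGardingCone.add_and_esymmRatio_add_le {k : ℕ} {s : Finset ι} {f g : ι → ℝ}
    (hf : InGardingCone k s f) (hg : InGardingCone k s g) :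
    InGardingCone k s (f + g) ∧
      esymmRatio s f k + esymmRatio s g k ≤ esymmRatio s (f + g) k := by
  induction k generalizing s with
  | zero =>
    refine ⟨fun j hj => ?_, ?_⟩
    · obtain rfl : j = 0 := by omega
      simp
    · simp [esymmRatio, esymmOn_one, Finset.sum_add_distrib]
  | succ k ih =>
    obtain ⟨hfg, hle⟩ := ih (hf.mono (Nat.le_succ k)) (hg.mono (Nat.le_succ k))
    have hpos : ∀ {u : ι → ℝ}, InGardingCone (k + 1) s u → 0 < esymmRatio s u k := fun hu =>
      div_pos (hu _ le_rfl) (hu _ (Nat.le_succ k))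
    have hfg' : InGardingCone (k + 1) s (f + g) := by
      refine InGardingCone.succ_iff.2 ⟨hfg, ?_⟩
      have h : 0 < esymmRatio s (f + g) k := by linarith [hpos hf, hpos hg]
      exact (div_pos_iff_of_pos_right (hfg k le_rfl)).1 h
    refine ⟨hfg', ?_⟩
    have hk : (0 : ℝ) < k + 2 := by positivity
    refine le_of_mul_le_mul_left ?_ hk
    rw [mul_add, esymmRatio_succ_eq_sum hf, esymmRatio_succ_eq_sum hg,
      esymmRatio_succ_eq_sum hfg', ← Finset.sum_add_distrib]
    refine Finset.sum_le_sum fun i hi => ?_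
    have hden : ∀ {u : ι → ℝ}, InGardingCone (k + 1) s u →
        0 < u i + esymmRatio (s.erase i) u k := fun hu => by
      rw [add_esymmRatio_erase hu hi]
      exact div_pos (hu _ le_rfl) (hu.erase hi k le_rfl)
    have hs := (ih (hf.erase hi) (hg.erase hi)).2
    have h1 := add_sq_div_add_le (a := f i) (b := g i) (hden hf) (hden hg)
    have h2 : (f i + g i) ^ 2 / ((f + g) i + esymmRatio (s.erase i) (f + g) k) ≤
        (f i + g i) ^ 2 / ((f i + esymmRatio (s.erase i) f k) +
          (g i + esymmRatio (s.erase i) g k)) := by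
      refine div_le_div_of_nonneg_left (sq_nonneg _) (add_pos (hden hf) (hden hg)) ?_
      simp only [Pi.add_apply]
      linarith
    simp only [Pi.add_apply] at h2 ⊢
    linarith

end GardingCone

/-! ### Characteristic polynomials of rank-one perturbations. -/

open Matrix in
lemma det_diagonal_add_vecMulVec {K m : Type*} [Field K] [Fintype m] [DecidableEq m] {d : m → K}
    (hd : ∀ i, d i ≠ 0) (u v : m → K) :
    (diagonal d + vecMulVec u v).det =
      ∏ i, d i + ∑ i, u i * v i * ∏ l ∈ Finset.univ.erase i, d l := by
  have hdet : IsUnit (diagonal d).det := by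
    rw [det_diagonal]
    exact (Finset.prod_ne_zero_iff.2 fun i _ => hd i).isUnit
  have hfac : diagonal d + vecMulVec u v =
      diagonal d * (1 + vecMulVec (fun i => (d i)⁻¹ * u i) v) := by
    ext i l
    rw [diagonal_mul]
    by_cases h : i = l
    · subst h; simp [vecMulVec_apply, mul_add]
      field_simp [hd i]
    · simp [vecMulVec_apply, h]
      field_simp [hd i]
  rw [hfac, det_mul, vecMulVec_eq Unit, det_one_add_replicateCol_mul_replicateRow, det_diagonal,
    mul_add, mul_one, dotProduct, Finset.mul_sum]
  congr 1
  refine Finset.sum_congr rfl fun i _ => ?_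
  rw [← Finset.mul_prod_erase Finset.univ d (Finset.mem_univ i)]
  field_simp [hd i]

open Matrix Polynomial in
lemma charpoly_diagonal_add_smul_vecMulVec {m : Type*} [Fintype m] [DecidableEq m]
    (d y : m → ℝ) (s : ℝ) :
    (diagonal d + s • vecMulVec y y).charpoly =
      ∏ i, (X - C (d i)) - ∑ i, C (s * y i ^ 2) * ∏ l ∈ Finset.univ.erase i, (X - C (d l)) := by
  -- Away from the values of `d` the diagonal part is invertible, and infinitely many points
  -- suffice.
  refine eq_of_infinite_eval_eq _ _ ((Set.finite_range d).infinite_compl.mono fun x hx => ?_)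
  have hne : ∀ i, x - d i ≠ 0 := fun i h => hx ⟨i, (sub_eq_zero.1 h).symm⟩
  have hM : scalar m x - (diagonal d + s • vecMulVec y y) =
      diagonal (fun i => x - d i) + vecMulVec (-s • y) y := by
    ext i l
    by_cases h : i = l
    · subst h; simp [vecMulVec_apply]; ring
    · simp [vecMulVec_apply, h]
  rw [Set.mem_ofPred_eq, eval_charpoly, hM, det_diagonal_add_vecMulVec hne]
  rw [eval_sub, eval_prod, eval_finsetSum, sub_eq_add_neg, ← Finset.sum_neg_distrib]
  simp only [eval_sub, eval_X, eval_C, eval_mul, eval_prod]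
  congr 1
  refine Finset.sum_congr rfl fun i _ => ?_
  simp only [Pi.smul_apply, smul_eq_mul]
  ring

open Polynomial in
lemma coeff_prod_X_sub_C_card_sub {ι : Type*} (s : Finset ι) (d : ι → ℝ) {N j : ℕ} (hN : s.card = N)
    (hj : j ≤ N) : (∏ i ∈ s, (X - C (d i))).coeff (N - j) = (-1) ^ j * esymmOn s d j := by
  subst hN
  have h := Multiset.prod_X_sub_C_coeff (s.val.map d) (k := s.card - j) (by simp)
  simp only [Multiset.map_map, Multiset.card_map, Finset.card_val, Finset.esymm_map_val] at h
  rw [Nat.sub_sub_self hj] at h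
  exact h

/-! ### Symmetric matrices, Newton transformations and rank-one monotonicity. -/

section SymmetricMatrices

open Matrix

variable {m : ℕ}

lemma Matrix.IsSymm.exists_orthogonal_diagonal {A : Matrix (Fin m) (Fin m) ℝ} (hA : A.IsSymm) :
    ∃ (U : Matrix (Fin m) (Fin m) ℝ) (d : Fin m → ℝ),
      U * Uᵀ = 1 ∧ A = U * diagonal d * Uᵀ := by
  have hH : A.IsHermitian := by
    rw [IsHermitian, conjTranspose_eq_transpose_of_trivial]; exact hA
  refine ⟨hH.eigenvectorUnitary, hH.eigenvalues, ?_, ?_⟩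
  · have := Unitary.mul_star_self_of_mem hH.eigenvectorUnitary.2
    rwa [star_eq_conjTranspose, conjTranspose_eq_transpose_of_trivial] at this
  · have := hH.spectral_theorem
    rw [Unitary.conjStarAlgAut_apply, star_eq_conjTranspose,
      conjTranspose_eq_transpose_of_trivial] at this
    exact this

variable {U : Matrix (Fin m) (Fin m) ℝ}

lemma isSymm_conj_diagonal (d : Fin m → ℝ) : (U * diagonal d * Uᵀ).IsSymm := by
  simp [IsSymm, transpose_mul, Matrix.mul_assoc]

lemma charpoly_orthogonal_conj (hU : U * Uᵀ = 1) (A : Matrix (Fin m) (Fin m) ℝ) :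
    (U * A * Uᵀ).charpoly = A.charpoly := by
  rw [charpoly_mul_comm, ← Matrix.mul_assoc, mul_eq_one_comm.1 hU, Matrix.one_mul]

lemma sigma_orthogonal_conj (hU : U * Uᵀ = 1) (j : ℕ) (A : Matrix (Fin m) (Fin m) ℝ) :
    sigma j (U * A * Uᵀ) = sigma j A := by
  rw [sigma, sigma, charpoly_orthogonal_conj hU]

lemma sigma_diagonal (j : ℕ) (d : Fin m → ℝ) :
    sigma j (diagonal d) = esymmOn Finset.univ d j := by
  have : (diagonal d).charpoly.roots = Finset.univ.val.map d := by
    rw [charpoly_diagonal, ← Polynomial.roots_multiset_prod_X_sub_C (Finset.univ.val.map d),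
      Multiset.map_map]
    rfl
  rw [sigma, this, Finset.esymm_map_val]
  rfl

lemma sigma_conj_diagonal (hU : U * Uᵀ = 1) (j : ℕ) (d : Fin m → ℝ) :
    sigma j (U * diagonal d * Uᵀ) = esymmOn Finset.univ d j := by
  rw [sigma_orthogonal_conj hU, sigma_diagonal]

lemma sigma_zero (A : Matrix (Fin m) (Fin m) ℝ) : sigma 0 A = 1 := by
  simp [sigma, Multiset.esymm]

lemma Matrix.IsSymm.coeff_charpoly {A : Matrix (Fin m) (Fin m) ℝ} (hA : A.IsSymm) {j : ℕ}
    (hj : j ≤ m) : A.charpoly.coeff (m - j) = (-1) ^ j * sigma j A := by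
  obtain ⟨U, d, hU, rfl⟩ := hA.exists_orthogonal_diagonal
  rw [charpoly_orthogonal_conj hU, sigma_conj_diagonal hU, charpoly_diagonal,
    coeff_prod_X_sub_C_card_sub _ _ (by simp) hj]

/-- Identifies the eigenvalue of the Newton transformation on the `i`-th eigenvector. -/
lemma sum_neg_pow_mul_esymmOn {ι : Type*} [DecidableEq ι] {s : Finset ι} {i : ι} (hi : i ∈ s)
    (d : ι → ℝ) (k : ℕ) :
    ∑ j ∈ Finset.range (k + 1), (-1) ^ j * esymmOn s d (k - j) * d i ^ j =
      esymmOn (s.erase i) d k := by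
  induction k with
  | zero => simp
  | succ k ih =>
    rw [Finset.sum_range_succ']
    have : ∀ j ∈ Finset.range (k + 1),
        (-1 : ℝ) ^ (j + 1) * esymmOn s d (k + 1 - (j + 1)) * d i ^ (j + 1) =
          - d i * ((-1) ^ j * esymmOn s d (k - j) * d i ^ j) := fun j _ => by
      rw [Nat.add_sub_add_right]; ring
    rw [Finset.sum_congr rfl this, ← Finset.mul_sum, ih]
    simp only [pow_zero, one_mul, Nat.sub_zero, mul_one]
    rw [esymmOn_erase_succ hi]
    ring

lemma newtonTransform_conj_diagonal (hU : U * Uᵀ = 1) (k : ℕ) (d : Fin m → ℝ) :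
    newtonTransform k (U * diagonal d * Uᵀ) =
      U * diagonal (fun i => esymmOn (Finset.univ.erase i) d k) * Uᵀ := by
  have hU' : Uᵀ * U = 1 := mul_eq_one_comm.1 hU
  have hpow : ∀ j : ℕ, (U * diagonal d * Uᵀ) ^ j = U * diagonal (d ^ j) * Uᵀ := by
    intro j
    induction j with
    | zero => simp [hU]
    | succ j ih =>
      rw [pow_succ, ih]
      calc U * diagonal (d ^ j) * Uᵀ * (U * diagonal d * Uᵀ)
          = U * diagonal (d ^ j) * (Uᵀ * U) * diagonal d * Uᵀ := by simp only [Matrix.mul_assoc]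
        _ = U * (diagonal (d ^ j) * diagonal d) * Uᵀ := by
          rw [hU', Matrix.mul_one]; simp only [Matrix.mul_assoc]
        _ = _ := by rw [diagonal_mul_diagonal, pow_succ]; rfl
  have hdiag : diagonal (fun i => esymmOn (Finset.univ.erase i) d k) =
      ∑ j ∈ Finset.range (k + 1),
        ((-1 : ℝ) ^ j * esymmOn Finset.univ d (k - j)) • diagonal (d ^ j) := by
    ext i l
    rw [Matrix.sum_apply]
    by_cases h : i = l
    · subst h
      simp [← sum_neg_pow_mul_esymmOn (Finset.mem_univ i) d k]
    · simp [h]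
  rw [hdiag, newtonTransform, Finset.mul_sum, Finset.sum_mul]
  refine Finset.sum_congr rfl fun j _ => ?_
  rw [sigma_conj_diagonal hU, hpow, Matrix.mul_smul, Matrix.smul_mul]

/-- The quadratic form of the Newton transformation, in an eigenbasis. -/
lemma dotProduct_newtonTransform_conj (hU : U * Uᵀ = 1) (k : ℕ) (d x : Fin m → ℝ) :
    x ⬝ᵥ newtonTransform k (U * diagonal d * Uᵀ) *ᵥ x =
      ∑ i, (Uᵀ *ᵥ x) i ^ 2 * esymmOn (Finset.univ.erase i) d k := by
  rw [newtonTransform_conj_diagonal hU, ← mulVec_mulVec, ← mulVec_mulVec, dotProduct_mulVec,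
    ← mulVec_transpose, dotProduct]
  refine Finset.sum_congr rfl fun i _ => ?_
  rw [mulVec_diagonal]
  ring

/-- Elementary symmetric functions are affine along rank-one perturbations. -/
theorem sigma_succ_add_smul_vecMulVec {A : Matrix (Fin m) (Fin m) ℝ} (hA : A.IsSymm) {j : ℕ}
    (hj : j + 1 ≤ m) (s : ℝ) (x : Fin m → ℝ) :
    sigma (j + 1) (A + s • vecMulVec x x) =
      sigma (j + 1) A + s * (x ⬝ᵥ newtonTransform j A *ᵥ x) := by
  obtain ⟨U, d, hU, rfl⟩ := hA.exists_orthogonal_diagonal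
  have hconj : U * diagonal d * Uᵀ + s • vecMulVec x x =
      U * (diagonal d + s • vecMulVec (Uᵀ *ᵥ x) (Uᵀ *ᵥ x)) * Uᵀ := by
    rw [Matrix.mul_add, Matrix.add_mul, Matrix.mul_smul, Matrix.smul_mul, mul_vecMulVec,
      vecMulVec_mul, ← mulVec_transpose, transpose_transpose, mulVec_mulVec, hU, one_mulVec]
  rw [hconj, dotProduct_newtonTransform_conj hU, sigma_orthogonal_conj hU,
    sigma_orthogonal_conj hU, sigma_diagonal]
  generalize Uᵀ *ᵥ x = y
  have hsymm : (diagonal d + s • vecMulVec y y).IsSymm := by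
    ext i l
    by_cases h : i = l
    · subst h; simp
    · simp [vecMulVec_apply, h, Ne.symm h, mul_comm]
  have h1 := hsymm.coeff_charpoly hj
  rw [charpoly_diagonal_add_smul_vecMulVec, Polynomial.coeff_sub,
    coeff_prod_X_sub_C_card_sub _ _ (by simp) hj, Polynomial.finsetSum_coeff] at h1
  have h2 : ∀ i ∈ Finset.univ, (Polynomial.C (s * y i ^ 2) *
      ∏ l ∈ Finset.univ.erase i, (Polynomial.X - Polynomial.C (d l))).coeff (m - (j + 1)) =
      (-1) ^ j * s * (y i ^ 2 * esymmOn (Finset.univ.erase i) d j) := fun i _ => by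
    -- Only `m - 1` linear factors remain, so this coefficient has codegree `j`, not `j + 1`.
    rw [Polynomial.coeff_C_mul, show m - (j + 1) = m - 1 - j by omega,
      coeff_prod_X_sub_C_card_sub _ _ (by simp) (by omega)]
    ring
  rw [Finset.sum_congr rfl h2, ← Finset.mul_sum, pow_succ] at h1
  have h3 : ((-1 : ℝ) ^ j) ≠ 0 := by simp
  refine mul_left_cancel₀ (mul_ne_zero h3 (by norm_num : (-1 : ℝ) ≠ 0)) ?_
  rw [← h1]
  ring

lemma conj_diagonal_mem_gammaPlus_iff (hU : U * Uᵀ = 1) {k : ℕ} {d : Fin m → ℝ} :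
    U * diagonal d * Uᵀ ∈ gammaPlus m k ↔ InGardingCone k Finset.univ d := by
  constructor
  · intro h j hj
    rcases Nat.eq_zero_or_pos j with rfl | hj0
    · simp
    · rw [← sigma_conj_diagonal hU]; exact h.2 j hj0 hj
  · intro h
    refine ⟨isSymm_conj_diagonal d, fun j _ hj => ?_⟩
    rw [sigma_conj_diagonal hU]
    exact h j hj

lemma sigma_pos_of_mem_gammaPlus {k j : ℕ} {A : Matrix (Fin m) (Fin m) ℝ} (hA : A ∈ gammaPlus m k)
    (hj : j ≤ k) : 0 < sigma j A := by
  rcases Nat.eq_zero_or_pos j with rfl | hj0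
  · simp [sigma_zero]
  · exact hA.2 j hj0 hj

lemma gammaPlus_anti {k l : ℕ} (hkl : k ≤ l) : gammaPlus m l ⊆ gammaPlus m k :=
  fun _ hA => ⟨hA.1, fun j h1 hj => hA.2 j h1 (hj.trans hkl)⟩

lemma dotProduct_newtonTransform_nonneg {k : ℕ} {A : Matrix (Fin m) (Fin m) ℝ}
    (hA : A ∈ gammaPlus m (k + 1)) (x : Fin m → ℝ) : 0 ≤ x ⬝ᵥ newtonTransform k A *ᵥ x := by
  obtain ⟨U, d, hU, rfl⟩ := hA.1.exists_orthogonal_diagonal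
  rw [conj_diagonal_mem_gammaPlus_iff hU] at hA
  rw [dotProduct_newtonTransform_conj hU]
  exact Finset.sum_nonneg fun i hi =>
    mul_nonneg (sq_nonneg _) (hA.erase hi k le_rfl).le

/-- Newton's inequality for the quadratic forms of the Newton transformations. -/
lemma sigma_mul_dotProduct_newtonTransform_le {A : Matrix (Fin m) (Fin m) ℝ} (hA : A.IsSymm)
    (k : ℕ) (x : Fin m → ℝ) :
    sigma (k + 2) A * (x ⬝ᵥ newtonTransform k A *ᵥ x) ≤
      sigma (k + 1) A * (x ⬝ᵥ newtonTransform (k + 1) A *ᵥ x) := by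
  obtain ⟨U, d, hU, rfl⟩ := hA.exists_orthogonal_diagonal
  rw [dotProduct_newtonTransform_conj hU, dotProduct_newtonTransform_conj hU,
    sigma_conj_diagonal hU, sigma_conj_diagonal hU, Finset.mul_sum, Finset.mul_sum]
  refine Finset.sum_le_sum fun i hi => ?_
  rw [mul_left_comm, mul_left_comm (esymmOn Finset.univ d (k + 1))]
  refine mul_le_mul_of_nonneg_left ?_ (sq_nonneg _)
  -- The terms containing `d i` cancel, leaving Newton's inequality for the remaining eigenvalues.
  rw [esymmOn_erase_succ hi d (k + 1), esymmOn_erase_succ hi d k]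
  nlinarith [esymmOn_mul_esymmOn_le (Finset.univ.erase i) d k]

/-- The quotient of consecutive elementary symmetric functions of the eigenvalues. -/
noncomputable def sigmaRatio (k : ℕ) (A : Matrix (Fin m) (Fin m) ℝ) : ℝ :=
  sigma (k + 1) A / sigma k A

lemma sigmaRatio_pos {k j : ℕ} {A : Matrix (Fin m) (Fin m) ℝ} (hA : A ∈ gammaPlus m k)
    (hj : j < k) : 0 < sigmaRatio j A :=
  div_pos (sigma_pos_of_mem_gammaPlus hA hj) (sigma_pos_of_mem_gammaPlus hA hj.le)

lemma prod_sigmaRatio {k : ℕ} {A : Matrix (Fin m) (Fin m) ℝ} (hA : A ∈ gammaPlus m k) :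
    ∏ j ∈ Finset.range k, sigmaRatio j A = sigma k A := by
  induction k with
  | zero => simp [sigma_zero]
  | succ k ih =>
    rw [Finset.prod_range_succ, ih (gammaPlus_anti (Nat.le_succ k) hA), sigmaRatio,
      mul_div_cancel₀ _ (sigma_pos_of_mem_gammaPlus hA (Nat.le_succ k)).ne']

lemma sigma_smul {A : Matrix (Fin m) (Fin m) ℝ} (hA : A.IsSymm) (c : ℝ) (j : ℕ) :
    sigma j (c • A) = c ^ j * sigma j A := by
  obtain ⟨U, d, hU, rfl⟩ := hA.exists_orthogonal_diagonal
  rw [← Matrix.smul_mul, ← Matrix.mul_smul, ← diagonal_smul, sigma_conj_diagonal hU,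
    sigma_conj_diagonal hU, esymmOn_smul]

lemma smul_mem_gammaPlus {k : ℕ} {A : Matrix (Fin m) (Fin m) ℝ} (hA : A ∈ gammaPlus m k) {c : ℝ}
    (hc : 0 < c) : c • A ∈ gammaPlus m k :=
  ⟨hA.1.smul c, fun j h1 hj => by
    rw [sigma_smul hA.1]; exact mul_pos (pow_pos hc j) (hA.2 j h1 hj)⟩

lemma sigmaRatio_smul {A : Matrix (Fin m) (Fin m) ℝ} (hA : A.IsSymm) {c : ℝ} (hc : 0 < c) (j : ℕ) :
    sigmaRatio j (c • A) = c * sigmaRatio j A := by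
  rw [sigmaRatio, sigmaRatio, sigma_smul hA, sigma_smul hA, pow_succ, mul_assoc,
    mul_div_mul_left _ _ (pow_pos hc j).ne', mul_div_assoc]

lemma add_smul_vecMulVec_mem_gammaPlus {k : ℕ} (hk : k ≤ m) {A : Matrix (Fin m) (Fin m) ℝ}
    (hA : A ∈ gammaPlus m k) {s : ℝ} (hs : 0 ≤ s) (x : Fin m → ℝ) :
    A + s • vecMulVec x x ∈ gammaPlus m k := by
  refine ⟨hA.1.add (IsSymm.smul ?_ s), fun j h1 hj => ?_⟩
  · ext i l; simp [vecMulVec_apply, mul_comm]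
  · obtain ⟨j, rfl⟩ : ∃ i, j = i + 1 := ⟨j - 1, by omega⟩
    rw [sigma_succ_add_smul_vecMulVec hA.1 (by omega)]
    exact add_pos_of_pos_of_nonneg (hA.2 _ h1 hj)
      (mul_nonneg hs (dotProduct_newtonTransform_nonneg (gammaPlus_anti hj hA) x))

/-- Numerator and denominator are affine in `s`; after cross-multiplying, Newton's inequality
compares the slopes. -/
lemma sigmaRatio_le_add_smul_vecMulVec {k j : ℕ} (hk : k ≤ m) {A : Matrix (Fin m) (Fin m) ℝ}
    (hA : A ∈ gammaPlus m k) (hj : j < k) {s : ℝ} (hs : 0 ≤ s) (x : Fin m → ℝ) :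
    sigmaRatio j A ≤ sigmaRatio j (A + s • vecMulVec x x) := by
  have hA' := add_smul_vecMulVec_mem_gammaPlus hk hA hs x
  rw [sigmaRatio, sigmaRatio, div_le_div_iff₀ (sigma_pos_of_mem_gammaPlus hA hj.le)
    (sigma_pos_of_mem_gammaPlus hA' hj.le), sigma_succ_add_smul_vecMulVec hA.1 (by omega)]
  have hQ := dotProduct_newtonTransform_nonneg (gammaPlus_anti (Nat.succ_le_of_lt hj) hA) x
  cases j with
  | zero =>
    simp only [sigma_zero, mul_one]
    nlinarith [mul_nonneg hs hQ]
  | succ j =>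
    rw [sigma_succ_add_smul_vecMulVec hA.1 (by omega)]
    have := mul_le_mul_of_nonneg_left (sigma_mul_dotProduct_newtonTransform_le hA.1 j x) hs
    linarith

end SymmetricMatrices

/-! ### Superadditivity of the quotients for symmetric matrices. -/

section SpectralConcavity

open Matrix

variable {m : ℕ}

lemma convex_setOf_inGardingCone_and_le_esymmRatio {ι : Type*} [DecidableEq ι] (s : Finset ι)
    (k : ℕ) (c : ℕ → ℝ) :
    Convex ℝ {f : ι → ℝ | InGardingCone k s f ∧ ∀ j < k, c j ≤ esymmRatio s f j} := by
  rw [convex_iff_forall_pos]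
  intro f hf g hg a b ha hb hab
  have hf' := hf.1.smul ha
  have hg' := hg.1.smul hb
  refine ⟨(hf'.add_and_esymmRatio_add_le hg').1, fun j hj => ?_⟩
  have h := ((hf'.mono hj.le).add_and_esymmRatio_add_le (hg'.mono hj.le)).2
  rw [esymmRatio_smul _ _ _ ha, esymmRatio_smul _ _ _ hb] at h
  have h1 := mul_le_mul_of_nonneg_left (hf.2 j hj) ha.le
  have h2 := mul_le_mul_of_nonneg_left (hg.2 j hj) hb.le
  calc c j = a * c j + b * c j := by rw [← add_mul, hab, one_mul]
    _ ≤ _ := by linarith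

lemma sq_entries_mem_doublyStochastic {W : Matrix (Fin m) (Fin m) ℝ} (hW : W * Wᵀ = 1) :
    of (fun i l => W i l ^ 2) ∈ doublyStochastic ℝ (Fin m) := by
  have hW' : Wᵀ * W = 1 := mul_eq_one_comm.1 hW
  refine mem_doublyStochastic_iff_sum.2 ⟨fun i l => sq_nonneg _, fun i => ?_, fun l => ?_⟩
  · have := congrFun (congrFun hW i) i
    simpa [Matrix.mul_apply, sq] using this
  · have := congrFun (congrFun hW' l) l
    simpa [Matrix.mul_apply, sq] using this

/-- Schur's majorization: passing to the diagonal in an orthonormal basis stays in the Gårding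
cone and increases the quotients of elementary symmetric functions. -/
theorem diag_orthogonal_conj_of_mem_gammaPlus {k : ℕ} {A V : Matrix (Fin m) (Fin m) ℝ}
    (hA : A ∈ gammaPlus m k) (hV : V * Vᵀ = 1) :
    InGardingCone k Finset.univ (diag (Vᵀ * A * V)) ∧
      ∀ j < k, sigmaRatio j A ≤ esymmRatio Finset.univ (diag (Vᵀ * A * V)) j := by
  obtain ⟨U, d, hU, rfl⟩ := hA.1.exists_orthogonal_diagonal
  rw [conj_diagonal_mem_gammaPlus_iff hU] at hA
  set W := Vᵀ * U with hWdef
  have hW : W * Wᵀ = 1 := by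
    rw [hWdef, transpose_mul, transpose_transpose, Matrix.mul_assoc, ← Matrix.mul_assoc U, hU,
      Matrix.one_mul, mul_eq_one_comm.1 hV]
  have hdiag : diag (Vᵀ * (U * diagonal d * Uᵀ) * V) = of (fun i l => W i l ^ 2) *ᵥ d := by
    have : Vᵀ * (U * diagonal d * Uᵀ) * V = W * diagonal d * Wᵀ := by
      simp only [hWdef, transpose_mul, transpose_transpose, Matrix.mul_assoc]
    rw [this]
    ext i
    simp only [diag_apply, Matrix.mul_apply (M := W * diagonal d), mul_diagonal, transpose_apply,
      mulVec, dotProduct, of_apply]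
    exact Finset.sum_congr rfl fun l _ => by ring
  -- `K` is convex and contains every permutation of `d`, so by Birkhoff it contains each doubly
  -- stochastic image of `d`.
  let K : Set (Fin m → ℝ) := {f | InGardingCone k Finset.univ f ∧
    ∀ j < k, sigmaRatio j (U * diagonal d * Uᵀ) ≤ esymmRatio Finset.univ f j}
  have hK : Convex ℝ K := convex_setOf_inGardingCone_and_le_esymmRatio _ _ _
  have hK' : Convex ℝ {M : Matrix (Fin m) (Fin m) ℝ | M *ᵥ d ∈ K} :=
    hK.is_linear_preimage (f := fun M : Matrix (Fin m) (Fin m) ℝ => M *ᵥ d)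
      ⟨fun M N => add_mulVec M N d, fun c M => smul_mulVec c M d⟩
  have hperm : {M : Matrix (Fin m) (Fin m) ℝ | ∃ π, Equiv.Perm.permMatrix ℝ π = M} ⊆
      {M : Matrix (Fin m) (Fin m) ℝ | M *ᵥ d ∈ K} := by
    rintro _ ⟨π, rfl⟩
    have h : Equiv.Perm.permMatrix ℝ π *ᵥ d = d ∘ π := permMatrix_mulVec π
    rw [Set.mem_ofPred_eq, h]
    refine ⟨fun j hj => ?_, fun j _ => ?_⟩
    · rw [esymmOn_comp_equiv]; exact hA j hj
    · rw [sigmaRatio, esymmRatio, sigma_conj_diagonal hU, sigma_conj_diagonal hU,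
        esymmOn_comp_equiv, esymmOn_comp_equiv]
  have hmem := sq_entries_mem_doublyStochastic hW
  rw [← SetLike.mem_coe, doublyStochastic_eq_convexHull_permMatrix] at hmem
  rw [hdiag]
  exact convexHull_min hperm hK' hmem

/-- In an eigenbasis of `A + B` the diagonals of `A` and `B` add up to its eigenvalues, so the
vector inequality applies; Schur's majorization bounds the quotients of `A` and `B` by those of
their diagonals. -/
theorem add_mem_gammaPlus_and_sigmaRatio_add_le {k : ℕ} {A B : Matrix (Fin m) (Fin m) ℝ}
    (hA : A ∈ gammaPlus m k) (hB : B ∈ gammaPlus m k) :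
    A + B ∈ gammaPlus m k ∧ ∀ j < k, sigmaRatio j A + sigmaRatio j B ≤ sigmaRatio j (A + B) := by
  obtain ⟨V, d, hV, hd⟩ := (hA.1.add hB.1).exists_orthogonal_diagonal
  have hV' : Vᵀ * V = 1 := mul_eq_one_comm.1 hV
  have hsum : diag (Vᵀ * A * V) + diag (Vᵀ * B * V) = d := by
    rw [← diag_add, ← Matrix.add_mul, ← Matrix.mul_add, hd]
    have : Vᵀ * (V * diagonal d * Vᵀ) * V = (Vᵀ * V) * diagonal d * (Vᵀ * V) := by
      simp only [Matrix.mul_assoc]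
    rw [this, hV', Matrix.one_mul, Matrix.mul_one, diag_diagonal]
  obtain ⟨hA1, hA2⟩ := diag_orthogonal_conj_of_mem_gammaPlus hA hV
  obtain ⟨hB1, hB2⟩ := diag_orthogonal_conj_of_mem_gammaPlus hB hV
  have hcone := (hA1.add_and_esymmRatio_add_le hB1).1
  rw [hsum] at hcone
  refine ⟨?_, fun j hj => ?_⟩
  · rw [hd, conj_diagonal_mem_gammaPlus_iff hV]; exact hcone
  · have h := ((hA1.mono hj.le).add_and_esymmRatio_add_le (hB1.mono hj.le)).2
    rw [hsum] at h
    have hr : sigmaRatio j (A + B) = esymmRatio Finset.univ d j := by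
      rw [hd, sigmaRatio, esymmRatio, sigma_conj_diagonal hV, sigma_conj_diagonal hV]
    linarith [hA2 j hj, hB2 j hj]

end SpectralConcavity

/-! ### Geometric means. -/

/-- Superadditivity of the geometric mean. -/
lemma prod_rpow_add_prod_rpow_le {ι : Type*} {s : Finset ι} (hs : s.Nonempty) {a b : ι → ℝ}
    (ha : ∀ i ∈ s, 0 < a i) (hb : ∀ i ∈ s, 0 < b i) :
    (∏ i ∈ s, a i) ^ (1 / (s.card : ℝ)) + (∏ i ∈ s, b i) ^ (1 / (s.card : ℝ)) ≤
      (∏ i ∈ s, (a i + b i)) ^ (1 / (s.card : ℝ)) := by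
  have hcard : (0 : ℝ) < s.card := by exact_mod_cast hs.card_pos
  have hab : ∀ i ∈ s, 0 < a i + b i := fun i hi => add_pos (ha i hi) (hb i hi)
  have hP : 0 < (∏ i ∈ s, (a i + b i)) ^ (1 / (s.card : ℝ)) :=
    Real.rpow_pos_of_pos (Finset.prod_pos hab) _
  -- AM-GM for the ratios; the bounds for `c = a` and `c = b` sum to one.
  have key : ∀ c : ι → ℝ, (∀ i ∈ s, 0 < c i) →
      (∏ i ∈ s, c i) ^ (1 / (s.card : ℝ)) / (∏ i ∈ s, (a i + b i)) ^ (1 / (s.card : ℝ)) ≤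
        ∑ i ∈ s, 1 / (s.card : ℝ) * (c i / (a i + b i)) := by
    intro c hc
    have h := Real.geom_mean_le_arith_mean_weighted s (fun _ => 1 / (s.card : ℝ))
      (fun i => c i / (a i + b i)) (fun _ _ => by positivity)
      (by rw [Finset.sum_const, nsmul_eq_mul, mul_one_div_cancel hcard.ne'])
      (fun i hi => (div_pos (hc i hi) (hab i hi)).le)
    rwa [Real.finsetProd_rpow _ _ (fun i hi => (div_pos (hc i hi) (hab i hi)).le),
      Finset.prod_div_distrib, Real.div_rpow (Finset.prod_nonneg fun i hi => (hc i hi).le)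
        (Finset.prod_nonneg fun i hi => (hab i hi).le)] at h
  have h := add_le_add (key a ha) (key b hb)
  rw [← add_div, ← Finset.sum_add_distrib] at h
  have hone : ∑ i ∈ s, (1 / (s.card : ℝ) * (a i / (a i + b i)) +
      1 / (s.card : ℝ) * (b i / (a i + b i))) = 1 := by
    rw [Finset.sum_congr rfl fun i hi => show _ = 1 / (s.card : ℝ) by
      rw [← mul_add, ← add_div, div_self (hab i hi).ne', mul_one], Finset.sum_const, nsmul_eq_mul,
      mul_one_div_cancel hcard.ne']
  rwa [hone, div_le_one hP] at h

/-! ### The Schur complement, and concavity of `F_k`. -/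

section SchurComplement

open Matrix

variable {n : ℕ}

/-- The Schur complement `r - xᵀx / r₀₀` of the corner entry `r₀₀`. -/
noncomputable def cornerSchurComplement (R : Matrix (Fin (n + 1)) (Fin (n + 1)) ℝ) :
    Matrix (Fin n) (Fin n) ℝ :=
  lowerBlock R - (R 0 0)⁻¹ • vecMulVec (topRow R) (topRow R)

lemma isSymm_vecMulVec_self (x : Fin n → ℝ) : (vecMulVec x x).IsSymm := by
  ext i l
  simp [vecMulVec_apply, mul_comm]

lemma isSymm_lowerBlock {R : Matrix (Fin (n + 1)) (Fin (n + 1)) ℝ} (hR : R.IsSymm) :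
    (lowerBlock R).IsSymm :=
  hR.submatrix _

lemma lowerBlock_eq_cornerSchurComplement_add (R : Matrix (Fin (n + 1)) (Fin (n + 1)) ℝ) :
    lowerBlock R =
      cornerSchurComplement R + (R 0 0)⁻¹ • vecMulVec (topRow R) (topRow R) := by
  simp [cornerSchurComplement]

lemma mul_sigma_succ_cornerSchurComplement {R : Matrix (Fin (n + 1)) (Fin (n + 1)) ℝ}
    (hR : R.IsSymm) (h0 : R 0 0 ≠ 0) {j : ℕ} (hj : j + 1 ≤ n) :
    R 0 0 * sigma (j + 1) (cornerSchurComplement R) = gsOperator (j + 1) R := by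
  rw [cornerSchurComplement, sub_eq_add_neg, ← neg_smul,
    sigma_succ_add_smul_vecMulVec (isSymm_lowerBlock hR) hj, gsOperator, Nat.add_sub_cancel]
  field_simp
  ring

/-- Trades the coupled conditions on `r` and `F_k` for separate ones on `r₀₀` and the Schur
complement. The converse adds back a nonnegative rank-one matrix. -/
theorem mem_gsCone_iff {k : ℕ} (hk : 1 ≤ k) (hkn : k ≤ n)
    {R : Matrix (Fin (n + 1)) (Fin (n + 1)) ℝ} :
    R ∈ gsCone n k ↔ R.IsSymm ∧ 0 < R 0 0 ∧ cornerSchurComplement R ∈ gammaPlus n k := by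
  obtain ⟨k, rfl⟩ : ∃ i, k = i + 1 := ⟨k - 1, by omega⟩
  constructor
  · rintro ⟨hR, hr, hF⟩
    have hσ : ∀ j ≤ k, 0 < sigma (j + 1) (lowerBlock R) := fun j hj =>
      hr.2 _ (by omega) (by omega)
    -- Descending induction on the degree, with `i = k - j`: Newton's inequality passes positivity
    -- from `F_{j+2}` to `F_{j+1}`.
    have hgs : ∀ i j, i + j = k → 0 < gsOperator (j + 1) R := by
      intro i
      induction i with
      | zero => intro j hj; rw [zero_add] at hj; exact hj ▸ hF
      | succ i ih =>
        intro j hj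
        have h1 := ih (j + 1) (by omega)
        have hN := sigma_mul_dotProduct_newtonTransform_le (isSymm_lowerBlock hR) j (topRow R)
        have h2 := hσ j (by omega)
        have h3 := hσ (j + 1) (by omega)
        simp only [gsOperator, Nat.add_sub_cancel, sub_pos] at h1 ⊢
        refine lt_of_mul_lt_mul_left (a := sigma (j + 1 + 1) (lowerBlock R)) ?_ h3.le
        calc _ ≤ _ := hN
          _ < sigma (j + 1) (lowerBlock R) * (R 0 0 * sigma (j + 1 + 1) (lowerBlock R)) :=
            mul_lt_mul_of_pos_left h1 h2
          _ = _ := by ring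
    have h00 : 0 < R 0 0 := by
      have hQ := dotProduct_newtonTransform_nonneg hr (topRow R)
      simp only [gsOperator, Nat.add_sub_cancel, sub_pos] at hF
      exact (mul_pos_iff_of_pos_right (hσ k le_rfl)).1 (hQ.trans_lt hF)
    refine ⟨hR, h00, (isSymm_lowerBlock hR).sub ((isSymm_vecMulVec_self _).smul _),
      fun j h1 hj => ?_⟩
    obtain ⟨j, rfl⟩ : ∃ i, j = i + 1 := ⟨j - 1, by omega⟩
    have h := hgs (k - j) j (by omega)
    rw [← mul_sigma_succ_cornerSchurComplement hR h00.ne' (by omega)] at h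
    exact (mul_pos_iff_of_pos_left h00).1 h
  · rintro ⟨hR, h00, hY⟩
    refine ⟨hR, ?_, ?_⟩
    · rw [lowerBlock_eq_cornerSchurComplement_add]
      exact add_smul_vecMulVec_mem_gammaPlus hkn hY (inv_pos.2 h00).le _
    · rw [← mul_sigma_succ_cornerSchurComplement hR h00.ne' hkn]
      exact mul_pos h00 (hY.2 _ hk le_rfl)

lemma cornerSchurComplement_smul (R : Matrix (Fin (n + 1)) (Fin (n + 1)) ℝ) {c : ℝ} (hc : c ≠ 0) :
    cornerSchurComplement (c • R) = c • cornerSchurComplement R := by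
  ext i l
  simp [cornerSchurComplement, lowerBlock, topRow, vecMulVec_apply]
  field_simp

/-- Matrix form of `x²/a + y²/b - (x + y)²/(a + b) = (bx - ay)² / (ab(a + b))`. -/
lemma cornerSchurComplement_add {R S : Matrix (Fin (n + 1)) (Fin (n + 1)) ℝ}
    (hR : 0 < R 0 0) (hS : 0 < S 0 0) :
    cornerSchurComplement (R + S) = cornerSchurComplement R + cornerSchurComplement S +
      (R 0 0 * S 0 0 * (R 0 0 + S 0 0))⁻¹ •
        vecMulVec (S 0 0 • topRow R - R 0 0 • topRow S) (S 0 0 • topRow R - R 0 0 • topRow S) := by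
  have hRS : 0 < R 0 0 + S 0 0 := add_pos hR hS
  ext i l
  simp [cornerSchurComplement, lowerBlock, topRow, vecMulVec_apply]
  field_simp
  ring

/-- The factors `r₀₀, φ₁, φ₂, …` of `gsOperator`, where `φⱼ` are the quotients of consecutive
elementary symmetric functions of the corner Schur complement. -/
noncomputable def gsFactor (R : Matrix (Fin (n + 1)) (Fin (n + 1)) ℝ) : ℕ → ℝ
  | 0 => R 0 0
  | j + 1 => sigmaRatio j (cornerSchurComplement R)

variable {k : ℕ}

lemma prod_gsFactor (hk : 1 ≤ k) (hkn : k ≤ n) {R : Matrix (Fin (n + 1)) (Fin (n + 1)) ℝ}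
    (hR : R ∈ gsCone n k) : ∏ j ∈ Finset.range (k + 1), gsFactor R j = gsOperator k R := by
  obtain ⟨hsymm, h00, hY⟩ := (mem_gsCone_iff hk hkn).1 hR
  rw [Finset.prod_range_succ', mul_comm]
  simp only [gsFactor]
  rw [prod_sigmaRatio hY]
  obtain ⟨k, rfl⟩ : ∃ i, k = i + 1 := ⟨k - 1, by omega⟩
  exact mul_sigma_succ_cornerSchurComplement hsymm h00.ne' hkn

lemma gsFactor_pos (hk : 1 ≤ k) (hkn : k ≤ n) {R : Matrix (Fin (n + 1)) (Fin (n + 1)) ℝ}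
    (hR : R ∈ gsCone n k) {j : ℕ} (hj : j < k + 1) : 0 < gsFactor R j := by
  obtain ⟨hsymm, h00, hY⟩ := (mem_gsCone_iff hk hkn).1 hR
  cases j with
  | zero => exact h00
  | succ j => exact sigmaRatio_pos hY (by omega)

lemma gsFactor_smul (hk : 1 ≤ k) (hkn : k ≤ n) {R : Matrix (Fin (n + 1)) (Fin (n + 1)) ℝ}
    (hR : R ∈ gsCone n k) {c : ℝ} (hc : 0 < c) (j : ℕ) :
    gsFactor (c • R) j = c * gsFactor R j := by
  cases j with
  | zero => rfl
  | succ j =>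
    rw [gsFactor, gsFactor, cornerSchurComplement_smul R hc.ne',
      sigmaRatio_smul ((mem_gsCone_iff hk hkn).1 hR).2.2.1 hc]

lemma smul_mem_gsCone (hk : 1 ≤ k) (hkn : k ≤ n) {R : Matrix (Fin (n + 1)) (Fin (n + 1)) ℝ}
    (hR : R ∈ gsCone n k) {c : ℝ} (hc : 0 < c) : c • R ∈ gsCone n k := by
  rw [mem_gsCone_iff hk hkn] at hR ⊢
  refine ⟨hR.1.smul c, mul_pos hc hR.2.1, ?_⟩
  rw [cornerSchurComplement_smul R hc.ne']
  exact smul_mem_gammaPlus hR.2.2 hc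

theorem add_mem_gsCone (hk : 1 ≤ k) (hkn : k ≤ n) {R S : Matrix (Fin (n + 1)) (Fin (n + 1)) ℝ}
    (hR : R ∈ gsCone n k) (hS : S ∈ gsCone n k) : R + S ∈ gsCone n k := by
  rw [mem_gsCone_iff hk hkn] at hR hS ⊢
  refine ⟨hR.1.add hS.1, add_pos hR.2.1 hS.2.1, ?_⟩
  rw [cornerSchurComplement_add hR.2.1 hS.2.1]
  refine add_smul_vecMulVec_mem_gammaPlus hkn
    (add_mem_gammaPlus_and_sigmaRatio_add_le hR.2.2 hS.2.2).1 ?_ _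
  have := hR.2.1
  have := hS.2.1
  positivity

theorem gsFactor_add_le (hk : 1 ≤ k) (hkn : k ≤ n) {R S : Matrix (Fin (n + 1)) (Fin (n + 1)) ℝ}
    (hR : R ∈ gsCone n k) (hS : S ∈ gsCone n k) {j : ℕ} (hj : j < k + 1) :
    gsFactor R j + gsFactor S j ≤ gsFactor (R + S) j := by
  rw [mem_gsCone_iff hk hkn] at hR hS
  cases j with
  | zero => exact le_rfl
  | succ j =>
    obtain ⟨hY, hle⟩ := add_mem_gammaPlus_and_sigmaRatio_add_le hR.2.2 hS.2.2
    simp only [gsFactor]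
    rw [cornerSchurComplement_add hR.2.1 hS.2.1]
    refine (hle j (by omega)).trans (sigmaRatio_le_add_smul_vecMulVec hkn hY (by omega) ?_ _)
    have := hR.2.1
    have := hS.2.1
    positivity

lemma gsOperator_smul (hk : 1 ≤ k) (hkn : k ≤ n) {R : Matrix (Fin (n + 1)) (Fin (n + 1)) ℝ}
    (hR : R ∈ gsCone n k) {c : ℝ} (hc : 0 < c) :
    gsOperator k (c • R) = c ^ (k + 1) * gsOperator k R := by
  rw [← prod_gsFactor hk hkn hR, ← prod_gsFactor hk hkn (smul_mem_gsCone hk hkn hR hc)]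
  simp [gsFactor_smul hk hkn hR hc, Finset.prod_mul_distrib]

lemma gsOperator_rpow_smul (hk : 1 ≤ k) (hkn : k ≤ n)
    {R : Matrix (Fin (n + 1)) (Fin (n + 1)) ℝ} (hR : R ∈ gsCone n k) {c : ℝ} (hc : 0 < c) :
    gsOperator k (c • R) ^ (1 / ((k : ℝ) + 1)) = c * gsOperator k R ^ (1 / ((k : ℝ) + 1)) := by
  rw [gsOperator_smul hk hkn hR hc, Real.mul_rpow (pow_pos hc _).le hR.2.2.le]
  congr 1
  have := Real.pow_rpow_inv_natCast hc.le (Nat.succ_ne_zero k)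
  rwa [Nat.succ_eq_add_one, Nat.cast_add_one, ← one_div] at this

theorem gsOperator_rpow_add_le (hk : 1 ≤ k) (hkn : k ≤ n)
    {R S : Matrix (Fin (n + 1)) (Fin (n + 1)) ℝ} (hR : R ∈ gsCone n k) (hS : S ∈ gsCone n k) :
    gsOperator k R ^ (1 / ((k : ℝ) + 1)) + gsOperator k S ^ (1 / ((k : ℝ) + 1)) ≤
      gsOperator k (R + S) ^ (1 / ((k : ℝ) + 1)) := by
  have hRS := add_mem_gsCone hk hkn hR hS
  have hpR : ∀ j ∈ Finset.range (k + 1), 0 < gsFactor R j := fun j hj =>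
    gsFactor_pos hk hkn hR (Finset.mem_range.1 hj)
  have hpS : ∀ j ∈ Finset.range (k + 1), 0 < gsFactor S j := fun j hj =>
    gsFactor_pos hk hkn hS (Finset.mem_range.1 hj)
  have h := prod_rpow_add_prod_rpow_le Finset.nonempty_range_add_one hpR hpS
  rw [Finset.card_range, Nat.cast_add_one, prod_gsFactor hk hkn hR, prod_gsFactor hk hkn hS] at h
  refine h.trans (Real.rpow_le_rpow
    (Finset.prod_nonneg fun j hj => (add_pos (hpR j hj) (hpS j hj)).le) ?_ (by positivity))
  rw [← prod_gsFactor hk hkn hRS]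
  exact Finset.prod_le_prod (fun j hj => (add_pos (hpR j hj) (hpS j hj)).le)
    fun j hj => gsFactor_add_le hk hkn hR hS (Finset.mem_range.1 hj)

theorem convex_gsCone (hk : 1 ≤ k) (hkn : k ≤ n) : Convex ℝ (gsCone n k) :=
  convex_iff_forall_pos.2 fun _ hR _ hS _ _ ha hb _ =>
    add_mem_gsCone hk hkn (smul_mem_gsCone hk hkn hR ha) (smul_mem_gsCone hk hkn hS hb)

theorem concaveOn_gsOperator_rpow (hk : 1 ≤ k) (hkn : k ≤ n) :
    ConcaveOn ℝ (gsCone n k) (fun R => gsOperator k R ^ (1 / ((k : ℝ) + 1))) := by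
  refine concaveOn_iff_forall_pos.2
    ⟨convex_gsCone hk hkn, fun R hR S hS a b ha hb _ => ?_⟩
  have h := gsOperator_rpow_add_le hk hkn (smul_mem_gsCone hk hkn hR ha)
    (smul_mem_gsCone hk hkn hS hb)
  rwa [gsOperator_rpow_smul hk hkn hR ha, gsOperator_rpow_smul hk hkn hS hb] at h

theorem concaveOn_log_gsOperator (hk : 1 ≤ k) (hkn : k ≤ n) :
    ConcaveOn ℝ (gsCone n k) (fun R => Real.log (gsOperator k R)) := by
  have hconc := concaveOn_gsOperator_rpow hk hkn
  have hk0 : (0 : ℝ) < k + 1 := by positivity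
  -- Reduces the claim to composing the concave root with the increasing concave logarithm.
  have hlog : ∀ R ∈ gsCone n k, Real.log (gsOperator k R) =
      (k + 1) * Real.log (gsOperator k R ^ (1 / ((k : ℝ) + 1))) := fun R hR => by
    rw [Real.log_rpow hR.2.2, ← mul_assoc, mul_one_div_cancel hk0.ne', one_mul]
  refine ⟨hconc.1, fun R hR S hS a b ha hb hab => ?_⟩
  have hpR := Real.rpow_pos_of_pos hR.2.2 (1 / ((k : ℝ) + 1))
  have hpS := Real.rpow_pos_of_pos hS.2.2 (1 / ((k : ℝ) + 1))
  have h1 := strictConcaveOn_log_Ioi.concaveOn.2 hpR hpS ha hb hab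
  have hpos := convex_Ioi (0 : ℝ) hpR hpS ha hb hab
  have h2 := Real.log_le_log hpos (hconc.2 hR hS ha hb hab)
  have h3 := mul_le_mul_of_nonneg_left (h1.trans h2) hk0.le
  simp only [smul_eq_mul] at h3 ⊢
  rw [hlog R hR, hlog S hS, hlog _ (hconc.1 hR hS ha hb hab)]
  linarith

end SchurComplement

theorem theorem2p1 (n k : ℕ) (hk : 1 ≤ k) (hkn : k ≤ n) :
    (∃ C : ConvexCone ℝ (Matrix (Fin (n + 1)) (Fin (n + 1)) ℝ),
      (C : Set (Matrix (Fin (n + 1)) (Fin (n + 1)) ℝ)) = gsCone n k) ∧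
    ConcaveOn ℝ (gsCone n k) (fun R => gsOperator k R ^ (1 / ((k : ℝ) + 1))) ∧
    ConcaveOn ℝ (gsCone n k) (fun R => Real.log (gsOperator k R)) :=
  ⟨⟨{ carrier := gsCone n k
      smul_mem' := fun _ hc _ hR => smul_mem_gsCone hk hkn hR hc
      add_mem' := fun _ hR _ hS => add_mem_gsCone hk hkn hR hS }, rfl⟩,
    concaveOn_gsOperator_rpow hk hkn, concaveOn_log_gsOperator hk hkn⟩
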